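/- Let $1<\alpha\le 2$, $T\ge 0$, $N\ge 0$, and let $\vec a(0),\dots,\vec a(N)\in\mathbb C^T$. For $z\in\mathbb C$ and $\beta>0$ put $z^{<\beta>}=|z|^{\beta-1}\bar z$, coordinatewise for vectors. A \emph{spectral density} is an integrable function $f$ on $(-\pi,\pi]$ with values in the complex $T\times T$ matrices such that, for almost every $\theta$, $u\mapsto u^{\top}f(\theta)u^{<\alpha-1>}$ is the $\alpha$-th power of a seminorm on $\mathbb C^T$ (for $T=1$: $f\ge 0$; for $\alpha=2$: $f(\theta)$ is Hermitian positive semidefinite). $L^\alpha(f)$ consists of the measurable $u:(-\pi,\pi]\to\mathbb C^T$ with $\|u\|^\alpha_{L^\alpha(f)}=\int_{-\pi}^{\pi}u^{\top}f\,u^{<\alpha-1>}d\theta<\infty$, and $L_N^\alpha(f)$ is the closed subspace generated by $e^{ij\theta}\delta_k$, $j\in\mathbb Z\setminus\{0,\dots,N\}$, $k=1,\dots,T$, where $\delta_1,\dots,\delta_T$ is the standard basis of $\mathbb C^T$. Let $A_N(e^{i\theta})=\sum_{j=0}^N\vec a(j)e^{ij\theta}$ and $$\Delta(h;f)=\int_{-\pi}^{\pi}\bigl(A_N(e^{i\theta})-h(\theta)\bigr)^{\top}f(\theta)\bigl(A_N(e^{i\theta})-h(\theta)\bigr)^{<\alpha-1>}d\theta,\qquad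 \Delta(f)=\inf_{h\in L_N^\alpha(f)}\Delta(h;f).$$ Let $D_f$ be a set of spectral densities and $H_D=\bigcap_{f\in D_f}L_N^\alpha(f)$. Call $f_0\in D_f$ \emph{least favorable} if $\Delta(f_0)=\max_{f\in D_f}\Delta(f)$. Call $h^0\in H_D$ \emph{minimax (robust)} if $\max_{f\in D_f}\Delta(h^0;f)$ is attained and equals $\min_{h\in H_D}\sup_{f\in D_f}\Delta(h;f)$. A $T$-dimensional sequence $\vec\xi(n)$, $n\in\mathbb Z$, of jointly symmetric $\alpha$-stable complex random vectors is \emph{harmonizable with spectral density $f$} if $\vec\xi(n)=\int_{-\pi}^{\pi}e^{in\theta}d\vec Z(\theta)$ (limit in probability of Riemann sums) for a symmetric $\alpha$-stable process $\vec Z$ on $[-\pi,\pi]$ with independent increments and matrix spectral measure $f(\theta)d\theta$, that is, for $u,v\in\mathbb C^T$ and $s\le t$ the covariation of $u^{\top}(\vec Z(t)-\vec Z(s))$ with $v^{\top}(\vec Z(t)-\vec Z(s))$ is $u^{\top}\bigl(\int_s^tf\,d\theta\bigr)v^{<\alpha-1>}$, and if moreover, for all vector trigonometric polynomials $p,q$,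 the covariation of $\int p^{\top}d\vec Z$ with $\int q^{\top}d\vec Z$ is $\int_{-\pi}^{\pi}p^{\top}f\,q^{<\alpha-1>}d\theta$. Here the covariation of jointly symmetric $\alpha$-stable complex variables is $[X,Y]_\alpha=\int x\,y^{<\alpha-1>}d\Gamma(x,y)$, with $\Gamma$ a (finite, symmetric) spectral measure of $(X,Y)$ on the unit sphere of $\mathbb C^2=\mathbb R^4$, and $\|X\|_\alpha^\alpha=[X,X]_\alpha$. Let $f_0\in D_f$ satisfy the minimality condition: $f_0(\theta)$ is positive definite for almost every $\theta$ and $\int_{-\pi}^{\pi}\mathrm{Tr}\,[f_0(\theta)^{-1/(\alpha-1)}]\,d\theta<\infty$. Let $\vec\xi$ be a harmonizable symmetric $\alpha$-stable sequence with spectral density $f_0$, and let $h^0=h(f_0)\in L_N^\alpha(f_0)$ be the spectral characteristic of the optimal linear estimate $\hat A_N\vec\xi$ of $A_N\vec\xi=\sum_{j=0}^N\vec a(j)^{\top}\vec\xi(j)$; that is, $\hat A_N\vec\xi=\int (h^0)^{\top}d\vec Z$ minimizes $\|A_N\vec\xi-Y\|_\alpha$ over all $Y$ in the closed linear manifold generated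 by the components of $\vec\xi(j)$, $j\in\mathbb Z\setminus\{0,\dots,N\}$. If $\max_{f\in D_f}\Delta(h(f_0);f)=\Delta(h(f_0);f_0)$ and $h(f_0)\in H_D$, then $\Delta(f_0)=\Delta(h(f_0);f_0)$, $f_0$ is least favorable in $D_f$, and $h(f_0)$ is minimax (robust). -/

import Mathlib

open MeasureTheory ProbabilityTheory Filter Topology Set
open scoped ENNReal Matrix ComplexOrder

noncomputable section

namespace StableInterpolation

/-! ### Symmetric stable random variables and covariation -/

/-- The signed power `z^{<β>} = |z|^{β-1} z̄` of a complex number. -/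
def spow (β : ℝ) (z : ℂ) : ℂ := ((‖z‖ ^ (β - 1) : ℝ) : ℂ) * (starRingEnd ℂ) z

/-- A real random variable is symmetric `α`-stable: its characteristic function is
`exp(-c|t|^α)` for some `c ≥ 0`. -/
def IsSaS {Ω : Type*} [MeasurableSpace Ω] (α : ℝ) (P : Measure Ω) (X : Ω → ℝ) : Prop :=
  AEMeasurable X P ∧
    ∃ c : ℝ, 0 ≤ c ∧ ∀ t : ℝ, charFun (P.map X) t = Complex.exp (-((c * |t| ^ α : ℝ) : ℂ))

/-- A family of complex random variables is jointly symmetric `α`-stable: every finite real linear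
combination of the real and imaginary parts (that is, every `Re ∑ cᵢ Xᵢ` with complex `cᵢ`) is
symmetric `α`-stable. -/
def IsJointlySaS {Ω ι : Type*} [MeasurableSpace Ω] (α : ℝ) (P : Measure Ω) (X : ι → Ω → ℂ) : Prop :=
  ∀ c : ι →₀ ℂ, IsSaS α P (fun ω => (c.sum fun i z => z * X i ω).re)

/-- `Γ` is a spectral measure of the pair `(X, Y)` of complex random variables, regarded as a random
vector of `ℝ⁴ = ℂ × ℂ`: a finite symmetric measure carried by the Euclidean unit sphere with
`E exp(i Re(s̄ X + t̄ Y)) = exp(-∫ |Re(s̄ x + t̄ y)|^α dΓ(x, y))`. -/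
structure IsSpectralMeasure {Ω : Type*} [MeasurableSpace Ω] (α : ℝ) (P : Measure Ω) (X Y : Ω → ℂ)
    (Γ : Measure (ℂ × ℂ)) : Prop where
  finite : IsFiniteMeasure Γ
  symmetric : Γ.map (fun z => -z) = Γ
  sphere : ∀ᵐ z ∂Γ, ‖z.1‖ ^ 2 + ‖z.2‖ ^ 2 = 1
  charFun_eq : ∀ s t : ℂ,
    ∫ ω, Complex.exp (Complex.I *
        (((starRingEnd ℂ) s * X ω + (starRingEnd ℂ) t * Y ω).re : ℂ)) ∂P =
      Complex.exp
        (-((∫ z, |((starRingEnd ℂ) s * z.1 + (starRingEnd ℂ) t * z.2).re| ^ α ∂Γ : ℝ) : ℂ))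

/-- The covariation `[X, Y]_α` exists and equals `r`. The number `r` does not depend on the choice
of `Γ`. In particular `HasCovariation α P X X r` says `‖X‖_α^α = r`. -/
def HasCovariation {Ω : Type*} [MeasurableSpace Ω] (α : ℝ) (P : Measure Ω) (X Y : Ω → ℂ)
    (r : ℂ) : Prop :=
  AEMeasurable X P ∧ AEMeasurable Y P ∧
    ∃ Γ : Measure (ℂ × ℂ), IsSpectralMeasure α P X Y Γ ∧ r = ∫ z, z.1 * spow (α - 1) z.2 ∂Γ

/-! ### Spectral densities -/

/-- The form `uᵀ F v^{<α-1>}`, the signed power being taken in each coordinate. -/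
def covForm {T : ℕ} (α : ℝ) (F : Matrix (Fin T) (Fin T) ℂ) (u v : Fin T → ℂ) : ℂ :=
  u ⬝ᵥ (F *ᵥ (fun k => spow (α - 1) (v k)))

/-- Spectral densities on `(-π, π]` of `T`-dimensional harmonizable symmetric `α`-stable sequences:
measurable, integrable, and such that for almost every `θ` the expression `uᵀ f(θ) u^{<α-1>}` is the
`α`-th power of a seminorm of `u`. For `T = 1` the last condition says `f ≥ 0`; for `α = 2` it
says that `f(θ)` is Hermitian positive semidefinite. -/
structure IsSpectralDensity {T : ℕ} (α : ℝ) (f : ℝ → Matrix (Fin T) (Fin T) ℂ) : Prop where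
  integrable : ∀ k l, IntegrableOn (fun θ => f θ k l) (Ioc (-Real.pi) Real.pi)
  seminorm : ∀ᵐ θ ∂(volume.restrict (Ioc (-Real.pi) Real.pi)),
    ∃ ν : Seminorm ℂ (Fin T → ℂ), ∀ u, covForm α (f θ) u u = ((ν u ^ α : ℝ) : ℂ)

/-- The minimality condition `∫ Tr[f(θ)^{-1/(α-1)}] dθ < ∞`. The negative power of the matrix
`f(θ)` makes sense when it is positive definite, and is taken in the functional calculus. -/
def IsMinimal {T : ℕ} (α : ℝ) (f : ℝ → Matrix (Fin T) (Fin T) ℂ) : Prop :=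
  (∀ᵐ θ ∂(volume.restrict (Ioc (-Real.pi) Real.pi)), (f θ).PosDef) ∧
    ∫⁻ θ in Ioc (-Real.pi) Real.pi,
      ENNReal.ofReal (cfc (fun x : ℝ => x ^ (-1 / (α - 1))) (f θ)).trace.re < ∞

/-! ### Harmonizable sequences -/

/-- The trigonometric polynomial `θ ↦ ∑ e^{inθ} c(n)` with vector coefficients. -/
def trigPoly {T : ℕ} (c : ℤ →₀ (Fin T → ℂ)) (θ : ℝ) : Fin T → ℂ :=
  c.sum fun n v => Complex.exp (Complex.I * n * θ) • v

/-- The linear combination `∑ c(n)ᵀ ξ(n)` of values of the sequence. -/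
def linComb {Ω : Type*} {T : ℕ} (ξ : ℤ → Fin T → Ω → ℂ) (c : ℤ →₀ (Fin T → ℂ)) (ω : Ω) : ℂ :=
  c.sum fun n v => v ⬝ᵥ (fun k => ξ n k ω)

/-- `ξ` is a `T`-dimensional harmonizable symmetric `α`-stable sequence whose (matrix) spectral
measure is absolutely continuous with density `f`: `ξ(n) = ∫ e^{inθ} dZ(θ)` for a vector symmetric
`α`-stable process `Z` on `[-π, π]` with independent increments and spectral measure `f(θ)dθ`. -/
def IsHarmonizable {Ω : Type*} [MeasurableSpace Ω] {T : ℕ} (α : ℝ) (P : Measure Ω)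
    (ξ : ℤ → Fin T → Ω → ℂ) (f : ℝ → Matrix (Fin T) (Fin T) ℂ) : Prop :=
  (∀ n k, Measurable (ξ n k)) ∧
  IsJointlySaS α P (fun i : ℤ × Fin T => ξ i.1 i.2) ∧
  (∃ Z : ℝ → Fin T → Ω → ℂ,
    (∀ θ k, Measurable (Z θ k)) ∧
    IsJointlySaS α P (fun i : Icc (-Real.pi) Real.pi × Fin T => Z i.1 i.2) ∧
    -- independent increments
    (∀ (m : ℕ) (t : ℕ → ℝ), Monotone t → (∀ j, t j ∈ Icc (-Real.pi) Real.pi) →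
      iIndepFun (fun (j : Fin m) ω k => Z (t (j + 1)) k ω - Z (t j) k ω) P) ∧
    -- spectral measure of the increments
    (∀ s t : ℝ, -Real.pi ≤ s → s ≤ t → t ≤ Real.pi → ∀ u v : Fin T → ℂ,
      HasCovariation α P (fun ω => u ⬝ᵥ fun k => Z t k ω - Z s k ω)
        (fun ω => v ⬝ᵥ fun k => Z t k ω - Z s k ω)
        (covForm α (Matrix.of fun k l => ∫ θ in s..t, f θ k l) u v)) ∧
    -- `ξ(n) = ∫ e^{inθ} dZ(θ)` as a limit in probability of Riemann sums
    (∀ (n : ℤ) (k : Fin T), TendstoInMeasure P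
      (fun (m : ℕ) ω => ∑ j ∈ Finset.range m,
        Complex.exp (Complex.I * n * ((-Real.pi + 2 * Real.pi * j / m : ℝ) : ℂ)) *
          (Z (-Real.pi + 2 * Real.pi * (j + 1) / m) k ω - Z (-Real.pi + 2 * Real.pi * j / m) k ω))
      atTop (ξ n k))) ∧
  -- covariation representation `[∫ pᵀ dZ, ∫ qᵀ dZ]_α = ∫ pᵀ f q^{<α-1>} dθ`
  ∀ p q : ℤ →₀ (Fin T → ℂ), HasCovariation α P (linComb ξ p) (linComb ξ q)
    (∫ θ in (-Real.pi)..Real.pi, covForm α (f θ) (trigPoly p θ) (trigPoly q θ))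

/-! ### Linear estimates and their spectral characteristics -/

/-- All frequencies of `c` lie outside `{0, 1, …, N}`. -/
def IsObserved {T : ℕ} (N : ℕ) (c : ℤ →₀ (Fin T → ℂ)) : Prop :=
  ∀ n ∈ c.support, ¬ (0 ≤ n ∧ n ≤ (N : ℤ))

/-- `‖u‖^α` in `L^α(f)`: the integral `∫ uᵀ f u^{<α-1>} dθ`. -/
def normPow {T : ℕ} (α : ℝ) (f : ℝ → Matrix (Fin T) (Fin T) ℂ) (u : ℝ → Fin T → ℂ) : ℝ≥0∞ :=
  ∫⁻ θ in Ioc (-Real.pi) Real.pi, ENNReal.ofReal (covForm α (f θ) (u θ) (u θ)).re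

/-- The subspace `L_N^α(f)`: the closure in `L^α(f)` of the trigonometric polynomials with
frequencies outside `{0, 1, …, N}`. -/
def LN {T : ℕ} (α : ℝ) (N : ℕ) (f : ℝ → Matrix (Fin T) (Fin T) ℂ) : Set (ℝ → Fin T → ℂ) :=
  {h | AEMeasurable h (volume.restrict (Ioc (-Real.pi) Real.pi)) ∧ normPow α f h < ∞ ∧
    ∀ ε : ℝ≥0∞, 0 < ε → ∃ c : ℤ →₀ (Fin T → ℂ), IsObserved N c ∧
      normPow α f (fun θ => h θ - trigPoly c θ) < ε}

/-- `A_N(e^{iθ}) = ∑_{j=0}^N a(j) e^{ijθ}`. -/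
def targetPoly {T N : ℕ} (a : Fin (N + 1) → Fin T → ℂ) (θ : ℝ) : Fin T → ℂ :=
  ∑ j : Fin (N + 1), Complex.exp (Complex.I * ((j : ℕ) : ℂ) * θ) • a j

/-- The functional `A_N ξ = ∑_{j=0}^N a(j)ᵀ ξ(j)`. -/
def target {Ω : Type*} {T N : ℕ} (a : Fin (N + 1) → Fin T → ℂ) (ξ : ℤ → Fin T → Ω → ℂ)
    (ω : Ω) : ℂ :=
  ∑ j : Fin (N + 1), a j ⬝ᵥ (fun k => ξ ((j : ℕ) : ℤ) k ω)

/-- `Y` belongs to `H^N(ξ)`, the closed linear manifold generated by `ξ(j)`, `j ∉ {0, 1, …, N}`.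
Convergence in `‖·‖_α` is convergence in probability. -/
def IsEstimate {Ω : Type*} [MeasurableSpace Ω] {T : ℕ} (P : Measure Ω) (N : ℕ)
    (ξ : ℤ → Fin T → Ω → ℂ) (Y : Ω → ℂ) : Prop :=
  AEMeasurable Y P ∧ ∃ c : ℕ → ℤ →₀ (Fin T → ℂ), (∀ m, IsObserved N (c m)) ∧
    TendstoInMeasure P (fun m => linComb ξ (c m)) atTop Y

/-- `Y` is the estimate `∫ hᵀ dZ` in `H^N(ξ)` with spectral characteristic `h ∈ L_N^α(f)`: `Y` is
the image of `h` under the isomorphism between `L^α(f)` and `H(ξ)` which sends `e^{inθ}δ_k` to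
`ξ_k(n)`. -/
def HasCharacteristic {Ω : Type*} [MeasurableSpace Ω] {T : ℕ} (α : ℝ) (P : Measure Ω) (N : ℕ)
    (ξ : ℤ → Fin T → Ω → ℂ) (f : ℝ → Matrix (Fin T) (Fin T) ℂ) (Y : Ω → ℂ)
    (h : ℝ → Fin T → ℂ) : Prop :=
  AEMeasurable Y P ∧ h ∈ LN α N f ∧
    ∃ c : ℕ → ℤ →₀ (Fin T → ℂ), (∀ m, IsObserved N (c m)) ∧
      Tendsto (fun m => normPow α f (fun θ => h θ - trigPoly (c m) θ)) atTop (𝓝 0) ∧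
      TendstoInMeasure P (fun m => linComb ξ (c m)) atTop Y

/-- `Y` is the optimal linear estimate of `A_N ξ`: the element of `H^N(ξ)` at the least distance
`‖A_N ξ - Y‖_α` from `A_N ξ`. -/
def IsOptimalEstimate {Ω : Type*} [MeasurableSpace Ω] {T N : ℕ} (α : ℝ) (P : Measure Ω)
    (a : Fin (N + 1) → Fin T → ℂ) (ξ : ℤ → Fin T → Ω → ℂ) (Y : Ω → ℂ) : Prop :=
  IsEstimate P N ξ Y ∧
    ∃ r : ℝ, HasCovariation α P (fun ω => target a ξ ω - Y ω) (fun ω => target a ξ ω - Y ω) r ∧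
      ∀ Y' : Ω → ℂ, IsEstimate P N ξ Y' → ∀ r' : ℝ,
        HasCovariation α P (fun ω => target a ξ ω - Y' ω) (fun ω => target a ξ ω - Y' ω) r' →
        r ≤ r'

/-! ### Errors, least favorable densities, minimax characteristics -/

/-- The error `Δ(h; f) = ∫ (A_N - h)ᵀ f (A_N - h)^{<α-1>} dθ`. -/
def estError {T N : ℕ} (α : ℝ) (a : Fin (N + 1) → Fin T → ℂ) (h : ℝ → Fin T → ℂ)
    (f : ℝ → Matrix (Fin T) (Fin T) ℂ) : ℝ≥0∞ :=
  normPow α f (fun θ => targetPoly a θ - h θ)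

/-- The error of the optimal estimate, `Δ(f) = Δ(h(f); f) = min_{h ∈ L_N^α(f)} Δ(h; f)`. -/
def optimalError {T N : ℕ} (α : ℝ) (a : Fin (N + 1) → Fin T → ℂ)
    (f : ℝ → Matrix (Fin T) (Fin T) ℂ) : ℝ≥0∞ :=
  ⨅ h ∈ LN α N f, estError α a h f

/-- `f₀ ∈ D` is least favorable in `D`: `Δ(f₀) = max_{f ∈ D} Δ(f)`. -/
def IsLeastFavorable {T N : ℕ} (α : ℝ) (a : Fin (N + 1) → Fin T → ℂ)
    (D : Set (ℝ → Matrix (Fin T) (Fin T) ℂ)) (f₀ : ℝ → Matrix (Fin T) (Fin T) ℂ) : Prop :=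
  f₀ ∈ D ∧ ∀ f ∈ D, optimalError α a f ≤ optimalError α a f₀

/-- `H_D = ⋂_{f ∈ D} L_N^α(f)`. -/
def HD {T : ℕ} (α : ℝ) (N : ℕ) (D : Set (ℝ → Matrix (Fin T) (Fin T) ℂ)) :
    Set (ℝ → Fin T → ℂ) :=
  ⋂ f ∈ D, LN α N f

/-- `h₀` is minimax (robust): `h₀ ∈ H_D`, the maximum of `Δ(h₀; ·)` over `D` is attained, and it is
the least value of `sup_{f ∈ D} Δ(h; f)` over `h ∈ H_D`. -/
def IsMinimax {T N : ℕ} (α : ℝ) (a : Fin (N + 1) → Fin T → ℂ)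
    (D : Set (ℝ → Matrix (Fin T) (Fin T) ℂ)) (h₀ : ℝ → Fin T → ℂ) : Prop :=
  h₀ ∈ HD α N D ∧
    ∃ M : ℝ≥0∞, IsGreatest (estError α a h₀ '' D) M ∧
      IsLeast ((fun h => ⨆ f ∈ D, estError α a h f) '' HD α N D) M

end StableInterpolation

end

open StableInterpolation

/-! The proof is a saddle point argument: `Δ(f) ≤ Δ(h₀; f) ≤ Δ(h₀; f₀) = Δ(f₀) ≤ Δ(h; f₀)` for
all `f ∈ D` and `h ∈ H_D`. Its substance is the equality `Δ(h₀; f₀) = Δ(f₀)`, which turns optimality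
of the random variable `Y₀` for `‖·‖_α` into optimality of the function `h₀` for `Δ(·; f₀)`.

For trigonometric polynomials both norms agree by harmonizability. They extend to the closures as
soon as `‖·‖_α` is continuous under convergence in probability. To see this, write the
characteristic function of a symmetric `α`-stable complex variable `X` as `exp(-φ)`. The mean of `φ`
over the unit circle is `‖X‖_α^α` times a positive constant depending only on `α`, while on that
circle `φ` is at most `2^{α/2}(φ(1) + φ(i))`. Convergence in probability gives `φ_m → φ` pointwise,
and the values at `1` and `i` then bound the `φ_m` uniformly on the circle, so the circular means
converge.
-/

namespace StableInterpolation

open scoped InnerProductSpace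

section SignedPower

variable {T : ℕ} (α β : ℝ)

lemma measurable_spow : Measurable (spow β) := by
  unfold spow
  fun_prop

lemma spow_neg (z : ℂ) : spow β (-z) = -spow β z := by
  simp [spow]

lemma norm_spow_le (z : ℂ) : ‖spow β z‖ ≤ ‖z‖ ^ β := by
  rcases eq_or_ne z 0 with rfl | hz
  · simpa [spow] using Real.zero_rpow_nonneg β
  · rw [spow, norm_mul, Complex.norm_real, RCLike.norm_conj, Real.norm_of_nonneg (by positivity),
      ← Real.rpow_add_one (norm_ne_zero_iff.2 hz), sub_add_cancel]

variable {α} in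
lemma mul_spow_sub_one_self (hα : α ≠ 0) (z : ℂ) :
    z * spow (α - 1) z = ((‖z‖ ^ α : ℝ) : ℂ) := by
  rcases eq_or_ne z 0 with rfl | hz
  · simp [Real.zero_rpow hα]
  · rw [spow, mul_left_comm, Complex.mul_conj, Complex.normSq_eq_norm_sq, ← Complex.ofReal_mul,
      ← Real.rpow_add_natCast (norm_ne_zero_iff.2 hz)]
    congr 2
    push_cast
    ring

lemma covForm_neg (F : Matrix (Fin T) (Fin T) ℂ) (u v : Fin T → ℂ) :
    covForm α F (-u) (-v) = covForm α F u v := by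
  have spow_neg_apply : (fun k => spow (α - 1) ((-v) k)) = -fun k => spow (α - 1) (v k) :=
    funext fun k => spow_neg _ (v k)
  rw [covForm, spow_neg_apply, Matrix.mulVec_neg, neg_dotProduct, dotProduct_neg, neg_neg, covForm]

lemma covForm_eq_sum (F : Matrix (Fin T) (Fin T) ℂ) (u v : Fin T → ℂ) :
    covForm α F u v = ∑ k, ∑ l, (u k * spow (α - 1) (v l)) * F k l := by
  simp only [covForm, dotProduct, Matrix.mulVec, Finset.mul_sum]
  exact Finset.sum_congr rfl fun _ _ => Finset.sum_congr rfl fun _ _ => by ring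

end SignedPower

section CircularMean

variable {α : ℝ}

/-- The absolute moment `∫ |cos θ|^α dθ` over a period, the constant by which averaging the real
inner product with a point of the unit circle recovers `|z|^α`. -/
noncomputable def cosMoment (α : ℝ) : ℝ := ∫ θ in (-Real.pi)..Real.pi, |Real.cos θ| ^ α

lemma cosMoment_pos (hα : 0 ≤ α) : 0 < cosMoment α :=
  intervalIntegral.integral_pos (by linarith [Real.pi_pos])
    (Real.continuous_cos.abs.rpow_const fun _ => Or.inr hα).continuousOn
    (fun _ _ => by positivity) ⟨0, ⟨by linarith [Real.pi_pos], Real.pi_pos.le⟩, by simp⟩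

lemma re_conj_mul (s z : ℂ) : ((starRingEnd ℂ) s * z).re = ⟪s, z⟫_ℝ := by
  rw [Complex.inner, mul_comm]

lemma inner_circleExp (θ : ℝ) (z : ℂ) :
    ⟪(Circle.exp θ : ℂ), z⟫_ℝ = ‖z‖ * Real.cos (θ - z.arg) := by
  rw [← re_conj_mul, Circle.coe_exp, Complex.exp_mul_I, Real.cos_sub, mul_add, mul_left_comm,
    mul_left_comm ‖z‖, Complex.norm_mul_cos_arg, Complex.norm_mul_sin_arg]
  simp [← Complex.ofReal_cos, ← Complex.ofReal_sin]

lemma integral_abs_inner_circleExp_rpow (α : ℝ) (z : ℂ) :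
    ∫ θ in (-Real.pi)..Real.pi, |⟪(Circle.exp θ : ℂ), z⟫_ℝ| ^ α = cosMoment α * ‖z‖ ^ α := by
  have periodic : Function.Periodic (fun θ => |Real.cos θ| ^ α) (2 * Real.pi) := fun θ => by
    simp only [Real.cos_add_two_pi]
  have translate : ∫ θ in (-Real.pi)..Real.pi, |Real.cos (θ - z.arg)| ^ α = cosMoment α := by
    have h := periodic.intervalIntegral_add_eq (-Real.pi - z.arg) (-Real.pi)
    rw [intervalIntegral.integral_comp_sub_right (fun θ => |Real.cos θ| ^ α), cosMoment]
    convert h using 2 <;> ring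
  simp_rw [inner_circleExp, abs_mul, abs_norm, Real.mul_rpow (norm_nonneg z) (abs_nonneg _)]
  rw [intervalIntegral.integral_const_mul, translate, mul_comm]

lemma measurable_coe_circleExp : Measurable fun θ : ℝ => (Circle.exp θ : ℂ) :=
  (continuous_subtype_val.comp Circle.exp.continuous).measurable

lemma abs_inner_rpow_le (hα : 0 ≤ α) {s : ℂ} (hs : ‖s‖ ≤ 1) (z : ℂ) :
    |⟪s, z⟫_ℝ| ^ α ≤ ‖z‖ ^ α :=
  Real.rpow_le_rpow (abs_nonneg _)
    ((abs_real_inner_le_norm s z).trans (mul_le_of_le_one_left (norm_nonneg z) hs)) hα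

lemma norm_rpow_le_abs_re_add_abs_im (hα : 0 ≤ α) (z : ℂ) :
    ‖z‖ ^ α ≤ √2 ^ α * (|z.re| ^ α + |z.im| ^ α) := by
  calc ‖z‖ ^ α ≤ (√2 * max |z.re| |z.im|) ^ α :=
        Real.rpow_le_rpow (norm_nonneg z) (Complex.norm_le_sqrt_two_mul_max z) hα
    _ = √2 ^ α * max |z.re| |z.im| ^ α := Real.mul_rpow (by positivity) (by positivity)
    _ ≤ √2 ^ α * (|z.re| ^ α + |z.im| ^ α) := by
        gcongr
        rcases max_choice |z.re| |z.im| with h | h <;> rw [h]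
        · exact le_add_of_nonneg_right (by positivity)
        · exact le_add_of_nonneg_left (by positivity)

end CircularMean

section Covariation

variable {Ω : Type*} [MeasurableSpace Ω] {α : ℝ} {P : Measure Ω} {X Y : Ω → ℂ}
  {Γ : Measure (ℂ × ℂ)}

/-- The exponent `φ` of a complex random variable whose characteristic function is `exp(-φ)`. -/
noncomputable def stableExponent (P : Measure Ω) (X : Ω → ℂ) (s : ℂ) : ℝ :=
  -Real.log ‖charFun (P.map X) s‖

namespace IsSpectralMeasure

lemma norm_fst_le_one (h : IsSpectralMeasure α P X Y Γ) : ∀ᵐ z ∂Γ, ‖z.1‖ ≤ 1 := by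
  filter_upwards [h.sphere] with z hz
  nlinarith [norm_nonneg z.1, sq_nonneg ‖z.2‖]

lemma norm_snd_le_one (h : IsSpectralMeasure α P X Y Γ) : ∀ᵐ z ∂Γ, ‖z.2‖ ≤ 1 := by
  filter_upwards [h.sphere] with z hz
  nlinarith [norm_nonneg z.2, sq_nonneg ‖z.1‖]

lemma integrable_norm_fst_rpow (hα : 0 ≤ α) (h : IsSpectralMeasure α P X Y Γ) :
    Integrable (fun z : ℂ × ℂ => ‖z.1‖ ^ α) Γ := by
  have := h.finite
  refine Integrable.of_bound (C := 1) (Measurable.aestronglyMeasurable (by fun_prop)) ?_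
  filter_upwards [h.norm_fst_le_one] with z hz
  rw [Real.norm_of_nonneg (by positivity)]
  exact Real.rpow_le_one (norm_nonneg _) hz hα

lemma integrable_abs_inner_sub_rpow (hα : 0 ≤ α) (h : IsSpectralMeasure α P X Y Γ) (s : ℂ) :
    Integrable (fun z : ℂ × ℂ => |⟪s, z.1 - z.2⟫_ℝ| ^ α) Γ := by
  have := h.finite
  refine Integrable.of_bound (C := (‖s‖ * 2) ^ α) (Measurable.aestronglyMeasurable (by fun_prop)) ?_
  filter_upwards [h.norm_fst_le_one, h.norm_snd_le_one] with z h₁ h₂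
  rw [Real.norm_of_nonneg (by positivity)]
  refine Real.rpow_le_rpow (abs_nonneg _) ((abs_real_inner_le_norm _ _).trans ?_) hα
  gcongr
  linarith [norm_sub_le z.1 z.2]

lemma integrable_abs_inner_fst_rpow (hα : 0 ≤ α) (h : IsSpectralMeasure α P X Y Γ) {s : ℂ}
    (hs : ‖s‖ ≤ 1) : Integrable (fun z : ℂ × ℂ => |⟪s, z.1⟫_ℝ| ^ α) Γ := by
  refine (h.integrable_norm_fst_rpow hα).mono' (Measurable.aestronglyMeasurable (by fun_prop))
    (Eventually.of_forall fun z => ?_)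
  rw [Real.norm_of_nonneg (by positivity)]
  exact abs_inner_rpow_le hα hs z.1

lemma charFun_map_eq (hX : AEMeasurable X P) (h : IsSpectralMeasure α P X Y Γ) (s : ℂ) :
    charFun (P.map X) s = Complex.exp (-((∫ z, |⟪s, z.1⟫_ℝ| ^ α ∂Γ : ℝ) : ℂ)) := by
  have h₀ := h.charFun_eq s 0
  simp only [map_zero, zero_mul, add_zero, re_conj_mul] at h₀
  rw [charFun_apply, integral_map hX (Continuous.aestronglyMeasurable (by fun_prop)), ← h₀]
  simp only [mul_comm Complex.I, real_inner_comm s]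

lemma norm_charFun_map_eq (hX : AEMeasurable X P) (h : IsSpectralMeasure α P X Y Γ) (s : ℂ) :
    ‖charFun (P.map X) s‖ = Real.exp (-∫ z, |⟪s, z.1⟫_ℝ| ^ α ∂Γ) := by
  rw [h.charFun_map_eq hX, Complex.norm_exp, Complex.neg_re, Complex.ofReal_re]

lemma stableExponent_eq (hX : AEMeasurable X P) (h : IsSpectralMeasure α P X Y Γ) (s : ℂ) :
    stableExponent P X s = ∫ z, |⟪s, z.1⟫_ℝ| ^ α ∂Γ := by
  rw [stableExponent, h.norm_charFun_map_eq hX, Real.log_exp, neg_neg]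

lemma integral_abs_inner_sub_rpow [IsProbabilityMeasure P] (h : IsSpectralMeasure α P X X Γ)
    (s : ℂ) : ∫ z, |⟪s, z.1 - z.2⟫_ℝ| ^ α ∂Γ = 0 := by
  -- At `(s, -s)` the characteristic function of `(X, X)` is `1`.
  have hs := h.charFun_eq s (-s)
  simp only [map_neg, neg_mul, ← sub_eq_add_neg, ← mul_sub, sub_self, mul_zero, Complex.zero_re,
    Complex.ofReal_zero, Complex.exp_zero, integral_const, probReal_univ, one_smul,
    re_conj_mul, ← Complex.ofReal_neg, ← Complex.ofReal_exp] at hs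
  exact neg_eq_zero.1 ((Real.exp_eq_one_iff _).1 (by exact_mod_cast hs.symm))

lemma ae_fst_eq_snd [IsProbabilityMeasure P] (hα : 0 < α) (h : IsSpectralMeasure α P X X Γ) :
    ∀ᵐ z ∂Γ, z.1 = z.2 := by
  have inner_eq_zero : ∀ s : ℂ, ∀ᵐ z ∂Γ, ⟪s, z.1 - z.2⟫_ℝ = 0 := fun s => by
    have h₀ := (integral_eq_zero_iff_of_nonneg (fun z => by positivity)
      (h.integrable_abs_inner_sub_rpow hα.le s)).1 (h.integral_abs_inner_sub_rpow s)
    filter_upwards [h₀] with z hz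
    exact abs_eq_zero.1 ((Real.rpow_eq_zero (abs_nonneg _) hα.ne').1 hz)
  filter_upwards [inner_eq_zero 1, inner_eq_zero Complex.I] with z hre him
  exact sub_eq_zero.1 (Complex.ext (by simpa [Complex.inner] using hre)
    (by simpa [Complex.inner] using him))

lemma integral_mul_spow [IsProbabilityMeasure P] (hα : 0 < α) (h : IsSpectralMeasure α P X X Γ) :
    ∫ z, z.1 * spow (α - 1) z.2 ∂Γ = ((∫ z, ‖z.1‖ ^ α ∂Γ : ℝ) : ℂ) := by
  rw [← integral_complex_ofReal]
  refine integral_congr_ae ?_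
  filter_upwards [h.ae_fst_eq_snd hα] with z hz
  rw [← hz, mul_spow_sub_one_self hα.ne']

lemma integral_integral_abs_inner_circleExp_rpow (hα : 0 ≤ α) (h : IsSpectralMeasure α P X Y Γ) :
    ∫ θ in (-Real.pi)..Real.pi, ∫ z, |⟪(Circle.exp θ : ℂ), z.1⟫_ℝ| ^ α ∂Γ =
      cosMoment α * ∫ z, ‖z.1‖ ^ α ∂Γ := by
  have := h.finite
  have : IsFiniteMeasure (volume.restrict (uIoc (-Real.pi) Real.pi)) := by
    rw [uIoc]
    infer_instance
  have integrable_prod : Integrable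
      (fun p : ℝ × (ℂ × ℂ) => |⟪(Circle.exp p.1 : ℂ), p.2.1⟫_ℝ| ^ α)
      ((volume.restrict (uIoc (-Real.pi) Real.pi)).prod Γ) := by
    have := measurable_coe_circleExp
    refine ((h.integrable_norm_fst_rpow hα).comp_snd _).mono'
      (Measurable.aestronglyMeasurable (by fun_prop)) (Eventually.of_forall fun p => ?_)
    rw [Real.norm_of_nonneg (by positivity)]
    exact abs_inner_rpow_le hα (Circle.norm_coe _).le p.2.1
  rw [intervalIntegral_integral_swap integrable_prod]
  simp_rw [integral_abs_inner_circleExp_rpow, integral_const_mul]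

end IsSpectralMeasure

namespace HasCovariation

variable {r : ℝ}

lemma charFun_map_ne_zero (h : HasCovariation α P X Y r) (s : ℂ) : charFun (P.map X) s ≠ 0 := by
  obtain ⟨hX, -, Γ, hΓ, -⟩ := h
  rw [hΓ.charFun_map_eq hX]
  exact Complex.exp_ne_zero _

lemma stableExponent_nonneg (h : HasCovariation α P X Y r) (s : ℂ) : 0 ≤ stableExponent P X s := by
  obtain ⟨hX, -, Γ, hΓ, -⟩ := h
  rw [hΓ.stableExponent_eq hX]
  exact integral_nonneg fun z => by positivity

lemma stableExponent_circleExp_le (hα : 0 ≤ α) (h : HasCovariation α P X Y r) (θ : ℝ) :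
    stableExponent P X (Circle.exp θ) ≤
      √2 ^ α * (stableExponent P X 1 + stableExponent P X Complex.I) := by
  obtain ⟨hX, -, Γ, hΓ, -⟩ := h
  have integrable_of_norm := fun {s : ℂ} (hs : ‖s‖ = 1) => hΓ.integrable_abs_inner_fst_rpow hα hs.le
  have integrable_one := integrable_of_norm norm_one
  have integrable_I := integrable_of_norm Complex.norm_I
  simp only [hΓ.stableExponent_eq hX]
  rw [← integral_add integrable_one integrable_I, ← integral_const_mul]
  refine integral_mono (integrable_of_norm (Circle.norm_coe _))
    ((integrable_one.add integrable_I).const_mul _) fun z => ?_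
  simpa [Complex.inner] using (abs_inner_rpow_le hα (Circle.norm_coe (Circle.exp θ)).le z.1).trans
    (norm_rpow_le_abs_re_add_abs_im hα z.1)

lemma integral_stableExponent_circleExp [IsProbabilityMeasure P] (hα : 0 < α)
    (h : HasCovariation α P X X r) :
    ∫ θ in (-Real.pi)..Real.pi, stableExponent P X (Circle.exp θ) = cosMoment α * r := by
  obtain ⟨hX, -, Γ, hΓ, hr⟩ := h
  simp only [hΓ.stableExponent_eq hX]
  rw [hΓ.integral_mul_spow hα, Complex.ofReal_inj] at hr
  rw [hΓ.integral_integral_abs_inner_circleExp_rpow hα.le, hr]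

end HasCovariation

variable [IsProbabilityMeasure P] {Xs : ℕ → Ω → ℂ}

lemma measurable_stableExponent : Measurable (stableExponent P X) :=
  measurable_charFun.norm.log.neg

lemma tendsto_charFun_map_of_tendstoInMeasure (hXs : ∀ m, AEMeasurable (Xs m) P)
    (hlim : TendstoInMeasure P Xs atTop X) (s : ℂ) :
    Tendsto (fun m => charFun (P.map (Xs m)) s) atTop (𝓝 (charFun (P.map X) s)) :=
  ProbabilityMeasure.tendsto_iff_tendsto_charFun.1 (hlim.tendstoInDistribution hXs).tendsto s

lemma tendsto_stableExponent_of_tendstoInMeasure (hXs : ∀ m, AEMeasurable (Xs m) P) {s : ℂ}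
    (hs : charFun (P.map X) s ≠ 0) (hlim : TendstoInMeasure P Xs atTop X) :
    Tendsto (fun m => stableExponent P (Xs m) s) atTop (𝓝 (stableExponent P X s)) :=
  ((tendsto_charFun_map_of_tendstoInMeasure hXs hlim s).norm.log (norm_ne_zero_iff.2 hs)).neg

theorem tendsto_covariation_of_tendstoInMeasure (hα : 0 < α) {rs : ℕ → ℝ} {r : ℝ}
    (hXs : ∀ m, HasCovariation α P (Xs m) (Xs m) (rs m)) (hX : HasCovariation α P X X r)
    (hlim : TendstoInMeasure P Xs atTop X) : Tendsto rs atTop (𝓝 r) := by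
  have pointwise (s : ℂ) :
      Tendsto (fun m => stableExponent P (Xs m) s) atTop (𝓝 (stableExponent P X s)) :=
    tendsto_stableExponent_of_tendstoInMeasure (fun m => (hXs m).1) (hX.charFun_map_ne_zero s) hlim
  obtain ⟨B, hB⟩ : ∃ B, ∀ᶠ m in atTop, ∀ θ, stableExponent P (Xs m) (Circle.exp θ) ≤ B := by
    have bound_tendsto := ((pointwise 1).add (pointwise Complex.I)).const_mul (√2 ^ α)
    obtain ⟨B, hB⟩ := bound_tendsto.isBoundedUnder_le
    refine ⟨B, ?_⟩
    filter_upwards [eventually_map.1 hB] with m hm θ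
    exact ((hXs m).stableExponent_circleExp_le hα.le θ).trans hm
  have dominated : ∀ᶠ m in atTop, ∀ᵐ θ, θ ∈ uIoc (-Real.pi) Real.pi →
      ‖stableExponent P (Xs m) (Circle.exp θ)‖ ≤ B := by
    filter_upwards [hB] with m hm
    refine Eventually.of_forall fun θ _ => ?_
    rw [Real.norm_of_nonneg ((hXs m).stableExponent_nonneg _)]
    exact hm θ
  have integrals :
      Tendsto (fun m => ∫ θ in (-Real.pi)..Real.pi, stableExponent P (Xs m) (Circle.exp θ)) atTop
        (𝓝 (∫ θ in (-Real.pi)..Real.pi, stableExponent P X (Circle.exp θ))) :=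
    intervalIntegral.tendsto_integral_filter_of_dominated_convergence (fun _ => B)
      (Eventually.of_forall fun m => (measurable_stableExponent.comp
        measurable_coe_circleExp).aestronglyMeasurable)
      dominated intervalIntegrable_const
      (Eventually.of_forall fun θ _ => pointwise (Circle.exp θ))
  simp_rw [fun m => (hXs m).integral_stableExponent_circleExp hα,
    hX.integral_stableExponent_circleExp hα] at integrals
  simpa only [inv_mul_cancel_left₀ (cosMoment_pos hα.le).ne'] using
    integrals.const_mul (cosMoment α)⁻¹

end Covariation

section TrigonometricPolynomial

variable {Ω : Type*} {T N : ℕ}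

lemma trigPoly_sub (c d : ℤ →₀ (Fin T → ℂ)) : trigPoly (c - d) = trigPoly c - trigPoly d :=
  funext fun _ => Finsupp.sum_sub_index fun _ _ _ => smul_sub _ _ _

lemma linComb_sub (ξ : ℤ → Fin T → Ω → ℂ) (c d : ℤ →₀ (Fin T → ℂ)) :
    linComb ξ (c - d) = linComb ξ c - linComb ξ d :=
  funext fun _ => Finsupp.sum_sub_index fun _ _ _ => sub_dotProduct _ _ _

/-- The coefficients of `A_N` as a finitely supported family over `ℤ`, through which both `A_N` and
the functional `A_N ξ` become instances of `trigPoly` and `linComb`. -/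
noncomputable def targetCoeff (a : Fin (N + 1) → Fin T → ℂ) : ℤ →₀ (Fin T → ℂ) :=
  ∑ j : Fin (N + 1), Finsupp.single ((j : ℕ) : ℤ) (a j)

lemma trigPoly_targetCoeff (a : Fin (N + 1) → Fin T → ℂ) :
    trigPoly (targetCoeff a) = targetPoly a := by
  ext1 θ
  rw [trigPoly, targetCoeff, ← Finsupp.sum_finsetSum_index (by simp) (by simp [smul_add])]
  simp [targetPoly]

lemma linComb_targetCoeff (a : Fin (N + 1) → Fin T → ℂ) (ξ : ℤ → Fin T → Ω → ℂ) :
    linComb ξ (targetCoeff a) = target a ξ := by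
  ext1 ω
  rw [linComb, targetCoeff, ← Finsupp.sum_finsetSum_index (by simp) (by simp [add_dotProduct])]
  simp [target]

lemma continuous_trigPoly (c : ℤ →₀ (Fin T → ℂ)) : Continuous (trigPoly c) := by
  unfold trigPoly Finsupp.sum
  fun_prop

lemma norm_trigPoly_le (c : ℤ →₀ (Fin T → ℂ)) (θ : ℝ) :
    ‖trigPoly c θ‖ ≤ c.sum fun _ v => ‖v‖ := by
  refine (norm_sum_le _ _).trans (Finset.sum_le_sum fun n _ => le_of_eq ?_)
  have exponent_eq : Complex.I * n * θ = ((n * θ : ℝ) : ℂ) * Complex.I := by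
    push_cast
    ring
  rw [norm_smul, exponent_eq, Complex.norm_exp_ofReal_mul_I, one_mul]

end TrigonometricPolynomial

section SpectralNorm

variable {T : ℕ} {α : ℝ} {f : ℝ → Matrix (Fin T) (Fin T) ℂ} {u v : ℝ → Fin T → ℂ}

/-- Lebesgue measure on the period `(-π, π]`, over which the norm of `L^α(f)` is integrated. -/
noncomputable abbrev periodMeasure : Measure ℝ := volume.restrict (Ioc (-Real.pi) Real.pi)

/-- The seminorm of `L^α(f)`, with the value `∞` outside that space. -/
noncomputable def densityNorm (α : ℝ) (f : ℝ → Matrix (Fin T) (Fin T) ℂ) (u : ℝ → Fin T → ℂ) :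
    ℝ≥0∞ :=
  normPow α f u ^ (1 / α)

lemma densityNorm_rpow (hα : α ≠ 0) (f : ℝ → Matrix (Fin T) (Fin T) ℂ) (u : ℝ → Fin T → ℂ) :
    densityNorm α f u ^ α = normPow α f u := by
  rw [densityNorm, ← ENNReal.rpow_mul, one_div_mul_cancel hα, ENNReal.rpow_one]

lemma densityNorm_sub_comm (α : ℝ) (f : ℝ → Matrix (Fin T) (Fin T) ℂ) (u v : ℝ → Fin T → ℂ) :
    densityNorm α f (u - v) = densityNorm α f (v - u) := by
  simp only [← neg_sub v u, densityNorm, normPow, Pi.neg_apply, covForm_neg]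

namespace IsSpectralDensity

lemma aemeasurable_covForm (hf : IsSpectralDensity α f) (hu : AEMeasurable u periodMeasure) :
    AEMeasurable (fun θ => covForm α (f θ) (u θ) (u θ)) periodMeasure := by
  have entry := fun k l => (hf.integrable k l).aestronglyMeasurable.aemeasurable
  have coord := aemeasurable_pi_iff.1 hu
  have spow_coord : ∀ k, AEMeasurable (fun θ => spow (α - 1) (u θ k)) periodMeasure :=
    fun k => (measurable_spow (α - 1)).comp_aemeasurable (coord k)
  simp_rw [covForm_eq_sum]
  fun_prop

lemma integrable_covForm (hα : 1 ≤ α) (hf : IsSpectralDensity α f)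
    (hu : AEMeasurable u periodMeasure) {K : ℝ} (hK : ∀ θ, ‖u θ‖ ≤ K) :
    Integrable (fun θ => covForm α (f θ) (u θ) (u θ)) periodMeasure := by
  have coord_le : ∀ θ k, ‖u θ k‖ ≤ K := fun θ k => (norm_le_pi_norm _ k).trans (hK θ)
  have coord := aemeasurable_pi_iff.1 hu
  simp_rw [covForm_eq_sum]
  refine integrable_finsetSum _ fun k _ => integrable_finsetSum _ fun l _ => ?_
  refine (hf.integrable k l).bdd_mul (c := K * K ^ (α - 1))
    ((coord k).mul ((measurable_spow _).comp_aemeasurable (coord l))).aestronglyMeasurable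
    (Eventually.of_forall fun θ => ?_)
  have spow_le : ‖spow (α - 1) (u θ l)‖ ≤ K ^ (α - 1) := (norm_spow_le _ _).trans <|
    Real.rpow_le_rpow (norm_nonneg _) (coord_le θ l) (sub_nonneg.2 hα)
  rw [norm_mul]
  exact mul_le_mul (coord_le θ k) spow_le (norm_nonneg _) ((norm_nonneg _).trans (hK θ))

lemma normPow_trigPoly_ne_top (hα : 1 ≤ α) (hf : IsSpectralDensity α f)
    (c : ℤ →₀ (Fin T → ℂ)) : normPow α f (trigPoly c) ≠ ∞ :=
  ((hf.integrable_covForm hα (continuous_trigPoly c).aemeasurable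
    (norm_trigPoly_le c)).re.lintegral_lt_top).ne

lemma integral_covForm_eq_toReal_normPow (hf : IsSpectralDensity α f)
    (hu : AEMeasurable u periodMeasure) :
    ∫ θ in (-Real.pi)..Real.pi, covForm α (f θ) (u θ) (u θ) =
      ((normPow α f u).toReal : ℂ) := by
  have eq_ofReal_re : (fun θ => covForm α (f θ) (u θ) (u θ)) =ᵐ[periodMeasure]
      fun θ => ((covForm α (f θ) (u θ) (u θ)).re : ℂ) := by
    filter_upwards [hf.seminorm] with θ ⟨ν, hν⟩
    rw [hν, Complex.ofReal_re]
  have re_nonneg : 0 ≤ᵐ[periodMeasure] fun θ => (covForm α (f θ) (u θ) (u θ)).re := by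
    filter_upwards [hf.seminorm] with θ ⟨ν, hν⟩
    rw [hν, Complex.ofReal_re]
    exact Real.rpow_nonneg (apply_nonneg ν _) _
  rw [intervalIntegral.integral_of_le (by linarith [Real.pi_pos]),
    integral_congr_ae eq_ofReal_re, integral_complex_ofReal,
    integral_eq_lintegral_of_nonneg_ae re_nonneg
      (Complex.measurable_re.comp_aemeasurable (hf.aemeasurable_covForm hu)).aestronglyMeasurable,
    normPow]

lemma exists_seminorm_eq_rpow (hα : 0 < α) (hf : IsSpectralDensity α f) :
    ∀ᵐ θ ∂periodMeasure, ∃ ν : Seminorm ℂ (Fin T → ℂ), ∀ w,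
      ENNReal.ofReal (covForm α (f θ) w w).re ^ (1 / α) = ENNReal.ofReal (ν w) := by
  filter_upwards [hf.seminorm] with θ ⟨ν, hν⟩
  refine ⟨ν, fun w => ?_⟩
  rw [hν, Complex.ofReal_re, ← ENNReal.ofReal_rpow_of_nonneg (apply_nonneg ν _) hα.le,
    ← ENNReal.rpow_mul, mul_one_div_cancel hα.ne', ENNReal.rpow_one]

/-- Minkowski's inequality in `L^α` for the scalar functions `θ ↦ ν_θ(u(θ))`. -/
lemma densityNorm_add_le (hα : 1 ≤ α) (hf : IsSpectralDensity α f)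
    (hu : AEMeasurable u periodMeasure) (hv : AEMeasurable v periodMeasure) :
    densityNorm α f (u + v) ≤ densityNorm α f u + densityNorm α f v := by
  have hα₀ : 0 < α := by linarith
  let g (w : ℝ → Fin T → ℂ) (θ : ℝ) : ℝ≥0∞ :=
    ENNReal.ofReal (covForm α (f θ) (w θ) (w θ)).re ^ (1 / α)
  have densityNorm_eq (w : ℝ → Fin T → ℂ) :
      densityNorm α f w = (∫⁻ θ, g w θ ^ α ∂periodMeasure) ^ (1 / α) := by
    simp only [g, densityNorm, normPow, ← ENNReal.rpow_mul, one_div_mul_cancel hα₀.ne',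
      ENNReal.rpow_one]
  have aemeasurable_g {w : ℝ → Fin T → ℂ} (hw : AEMeasurable w periodMeasure) :
      AEMeasurable (g w) periodMeasure :=
    (Complex.measurable_re.comp_aemeasurable
      (hf.aemeasurable_covForm hw)).ennreal_ofReal.pow_const _
  have g_add_le : ∀ᵐ θ ∂periodMeasure, g (u + v) θ ≤ (g u + g v) θ := by
    filter_upwards [hf.exists_seminorm_eq_rpow hα₀] with θ ⟨ν, hν⟩
    simp only [g, hν, Pi.add_apply]
    rw [← ENNReal.ofReal_add (apply_nonneg ν _) (apply_nonneg ν _)]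
    exact ENNReal.ofReal_le_ofReal (map_add_le_add ν _ _)
  calc densityNorm α f (u + v)
      ≤ (∫⁻ θ, (g u + g v) θ ^ α ∂periodMeasure) ^ (1 / α) := by
        rw [densityNorm_eq]
        gcongr ?_ ^ _
        exact lintegral_mono_ae (g_add_le.mono fun θ hθ => ENNReal.rpow_le_rpow hθ hα₀.le)
    _ ≤ densityNorm α f u + densityNorm α f v := by
        rw [densityNorm_eq, densityNorm_eq]
        exact ENNReal.lintegral_Lp_add_le (aemeasurable_g hu) (aemeasurable_g hv) hα

lemma densityNorm_le_add_sub (hα : 1 ≤ α) (hf : IsSpectralDensity α f)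
    (hu : AEMeasurable u periodMeasure) (hv : AEMeasurable v periodMeasure) :
    densityNorm α f u ≤ densityNorm α f v + densityNorm α f (u - v) := by
  simpa only [add_sub_cancel] using hf.densityNorm_add_le hα hv (hu.sub hv)

lemma tendsto_normPow {ι : Type*} {l : Filter ι} {us : ι → ℝ → Fin T → ℂ} (hα : 1 ≤ α)
    (hf : IsSpectralDensity α f) (hus : ∀ i, AEMeasurable (us i) periodMeasure)
    (hv : AEMeasurable v periodMeasure)
    (hlim : Tendsto (fun i => normPow α f (us i - v)) l (𝓝 0)) :
    Tendsto (fun i => normPow α f (us i)) l (𝓝 (normPow α f v)) := by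
  have hα₀ : 0 < α := by linarith
  have dist_tendsto : Tendsto (fun i => densityNorm α f (us i - v)) l (𝓝 0) := by
    simpa only [densityNorm, ENNReal.zero_rpow_of_pos (one_div_pos.2 hα₀)] using
      hlim.ennrpow_const (1 / α)
  have lower (i : ι) : densityNorm α f v - densityNorm α f (us i - v) ≤ densityNorm α f (us i) := by
    rw [tsub_le_iff_right, densityNorm_sub_comm]
    exact hf.densityNorm_le_add_sub hα hv (hus i)
  have upper (i : ι) : densityNorm α f (us i) ≤ densityNorm α f v + densityNorm α f (us i - v) :=
    hf.densityNorm_le_add_sub hα (hus i) hv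
  have norm_tendsto : Tendsto (fun i => densityNorm α f (us i)) l (𝓝 (densityNorm α f v)) := by
    refine tendsto_of_tendsto_of_tendsto_of_le_of_le ?_ ?_ lower upper
    · simpa only [tsub_zero] using
        ENNReal.Tendsto.sub tendsto_const_nhds dist_tendsto (Or.inr ENNReal.zero_ne_top)
    · simpa only [add_zero] using tendsto_const_nhds.add dist_tendsto
  simpa only [densityNorm_rpow hα₀.ne'] using norm_tendsto.ennrpow_const α

end IsSpectralDensity

end SpectralNorm

section OptimalEstimate

variable {Ω : Type*} [MeasurableSpace Ω] {P : Measure Ω} {T N : ℕ} {α : ℝ}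
  {f : ℝ → Matrix (Fin T) (Fin T) ℂ} {a : Fin (N + 1) → Fin T → ℂ} {ξ : ℤ → Fin T → Ω → ℂ}
  {Y : Ω → ℂ} {h : ℝ → Fin T → ℂ} {c : ℤ →₀ (Fin T → ℂ)}

lemma exists_seq_tendsto_of_mem_LN (hh : h ∈ LN α N f) :
    ∃ cs : ℕ → ℤ →₀ (Fin T → ℂ), (∀ m, IsObserved N (cs m)) ∧
      Tendsto (fun m => normPow α f (fun θ => h θ - trigPoly (cs m) θ)) atTop (𝓝 0) := by
  choose cs hobs hlt using fun m : ℕ => hh.2.2 (m : ℝ≥0∞)⁻¹ (by simp)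
  exact ⟨cs, hobs, tendsto_of_tendsto_of_tendsto_of_le_of_le tendsto_const_nhds
    ENNReal.tendsto_inv_nat_nhds_zero (fun _ => zero_le) fun m => (hlt m).le⟩

lemma estError_trigPoly (a : Fin (N + 1) → Fin T → ℂ) (c : ℤ →₀ (Fin T → ℂ))
    (f : ℝ → Matrix (Fin T) (Fin T) ℂ) :
    estError α a (trigPoly c) f = normPow α f (trigPoly (targetCoeff a - c)) := by
  rw [trigPoly_sub, trigPoly_targetCoeff]
  rfl

namespace IsSpectralDensity

lemma estError_trigPoly_ne_top (hα : 1 ≤ α) (hf : IsSpectralDensity α f)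
    (a : Fin (N + 1) → Fin T → ℂ) (c : ℤ →₀ (Fin T → ℂ)) :
    estError α a (trigPoly c) f ≠ ∞ := by
  rw [estError_trigPoly]
  exact hf.normPow_trigPoly_ne_top hα _

lemma tendsto_estError {ι : Type*} {l : Filter ι} {cs : ι → ℤ →₀ (Fin T → ℂ)} (hα : 1 ≤ α)
    (hf : IsSpectralDensity α f) (hh : AEMeasurable h periodMeasure)
    (hlim : Tendsto (fun i => normPow α f (fun θ => h θ - trigPoly (cs i) θ)) l (𝓝 0))
    (a : Fin (N + 1) → Fin T → ℂ) :
    Tendsto (fun i => estError α a (trigPoly (cs i)) f) l (𝓝 (estError α a h f)) := by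
  have aemeasurable_target : AEMeasurable (targetPoly a) periodMeasure := by
    rw [← trigPoly_targetCoeff]
    exact (continuous_trigPoly _).aemeasurable
  refine hf.tendsto_normPow hα
    (fun i => aemeasurable_target.sub (continuous_trigPoly (cs i)).aemeasurable)
    (aemeasurable_target.sub hh) (hlim.congr fun i => ?_)
  congr 1 with θ : 1
  exact (sub_sub_sub_cancel_left _ _ _).symm

end IsSpectralDensity

namespace IsHarmonizable

lemma hasCovariation_target_sub_linComb (hf : IsSpectralDensity α f)
    (hξ : IsHarmonizable α P ξ f) (a : Fin (N + 1) → Fin T → ℂ) (c : ℤ →₀ (Fin T → ℂ)) :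
    HasCovariation α P (target a ξ - linComb ξ c) (target a ξ - linComb ξ c)
      (estError α a (trigPoly c) f).toReal := by
  have covariation := hξ.2.2.2 (targetCoeff a - c) (targetCoeff a - c)
  rwa [hf.integral_covForm_eq_toReal_normPow (continuous_trigPoly _).aemeasurable,
    ← estError_trigPoly, linComb_sub, linComb_targetCoeff] at covariation

lemma isEstimate_linComb (hξ : IsHarmonizable α P ξ f) (hc : IsObserved N c) :
    IsEstimate P N ξ (linComb ξ c) :=
  ⟨(hξ.2.2.2 c c).1, fun _ => c, fun _ => hc, fun ε hε => by simp [hε.ne']⟩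

lemma ofReal_le_estError {r : ℝ} (hα : 1 ≤ α) (hf : IsSpectralDensity α f)
    (hξ : IsHarmonizable α P ξ f)
    (hr : ∀ Y : Ω → ℂ, IsEstimate P N ξ Y → ∀ r' : ℝ,
      HasCovariation α P (target a ξ - Y) (target a ξ - Y) r' → r ≤ r')
    (hh : h ∈ LN α N f) : ENNReal.ofReal r ≤ estError α a h f := by
  obtain ⟨cs, hobs, hlim⟩ := exists_seq_tendsto_of_mem_LN hh
  refine ge_of_tendsto' (hf.tendsto_estError hα hh.1 hlim a) fun m => ?_
  exact ENNReal.ofReal_le_of_le_toReal <|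
    hr _ (hξ.isEstimate_linComb (hobs m)) _ (hξ.hasCovariation_target_sub_linComb hf a (cs m))

lemma estError_eq_ofReal [IsProbabilityMeasure P] {r : ℝ} (hα : 1 ≤ α)
    (hf : IsSpectralDensity α f) (hξ : IsHarmonizable α P ξ f)
    (hchar : HasCharacteristic α P N ξ f Y h)
    (hr : HasCovariation α P (target a ξ - Y) (target a ξ - Y) r) :
    estError α a h f = ENNReal.ofReal r := by
  obtain ⟨-, hh, cs, -, hlim, hprob⟩ := hchar
  have residual_tendsto :
      TendstoInMeasure P (fun m => target a ξ - linComb ξ (cs m)) atTop (target a ξ - Y) := by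
    intro ε hε
    simpa only [Pi.sub_apply, edist_sub_left] using hprob ε hε
  have covariation_tendsto :
      Tendsto (fun m => (estError α a (trigPoly (cs m)) f).toReal) atTop (𝓝 r) :=
    tendsto_covariation_of_tendstoInMeasure (by linarith)
      (fun m => hξ.hasCovariation_target_sub_linComb hf a (cs m)) hr residual_tendsto
  refine tendsto_nhds_unique (hf.tendsto_estError hα hh.1 hlim a) ?_
  simpa only [ENNReal.ofReal_toReal (hf.estError_trigPoly_ne_top hα a _)] using
    ENNReal.tendsto_ofReal covariation_tendsto

end IsHarmonizable

theorem optimalError_eq_estError_of_isOptimalEstimate [IsProbabilityMeasure P] (hα : 1 ≤ α)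
    (hf : IsSpectralDensity α f) (hξ : IsHarmonizable α P ξ f)
    (hY : IsOptimalEstimate α P a ξ Y) (hchar : HasCharacteristic α P N ξ f Y h) :
    optimalError α a f = estError α a h f := by
  obtain ⟨-, r, hr, hle⟩ := hY
  refine le_antisymm (iInf₂_le h hchar.2.1) (le_iInf₂ fun h' hh' => ?_)
  rw [hξ.estError_eq_ofReal hα hf hchar hr]
  exact hξ.ofReal_le_estError hα hf hle hh'

end OptimalEstimate

section SaddlePoint

variable {T N : ℕ} {α : ℝ} {a : Fin (N + 1) → Fin T → ℂ}
  {D : Set (ℝ → Matrix (Fin T) (Fin T) ℂ)} {f₀ : ℝ → Matrix (Fin T) (Fin T) ℂ}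
  {h₀ : ℝ → Fin T → ℂ}

lemma optimalError_le_of_mem_HD {f : ℝ → Matrix (Fin T) (Fin T) ℂ} {h : ℝ → Fin T → ℂ}
    (hh : h ∈ HD α N D) (hf : f ∈ D) : optimalError α a f ≤ estError α a h f :=
  iInf₂_le h (mem_iInter₂.1 hh f hf)

theorem isLeastFavorable_of_isMaxOn (hopt : optimalError α a f₀ = estError α a h₀ f₀)
    (hf₀ : f₀ ∈ D) (hmax : IsMaxOn (estError α a h₀) D f₀) (hHD : h₀ ∈ HD α N D) :
    IsLeastFavorable α a D f₀ :=
  ⟨hf₀, fun f hf => calc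
    optimalError α a f ≤ estError α a h₀ f := optimalError_le_of_mem_HD hHD hf
    _ ≤ estError α a h₀ f₀ := hmax hf
    _ = optimalError α a f₀ := hopt.symm⟩

theorem isMinimax_of_isMaxOn (hopt : optimalError α a f₀ = estError α a h₀ f₀)
    (hf₀ : f₀ ∈ D) (hmax : IsMaxOn (estError α a h₀) D f₀) (hHD : h₀ ∈ HD α N D) :
    IsMinimax α a D h₀ := by
  have iSup_eq : ⨆ f ∈ D, estError α a h₀ f = estError α a h₀ f₀ :=
    le_antisymm (iSup₂_le fun f hf => hmax hf) (le_iSup₂_of_le f₀ hf₀ le_rfl)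
  refine ⟨hHD, estError α a h₀ f₀, ⟨mem_image_of_mem _ hf₀, forall_mem_image.2 fun f hf => hmax hf⟩,
    ⟨h₀, hHD, iSup_eq⟩, forall_mem_image.2 fun h hh => ?_⟩
  calc estError α a h₀ f₀ = optimalError α a f₀ := hopt.symm
    _ ≤ estError α a h f₀ := optimalError_le_of_mem_HD hh hf₀
    _ ≤ ⨆ f ∈ D, estError α a h f := le_iSup₂_of_le f₀ hf₀ le_rfl

end SaddlePoint

end StableInterpolation

theorem mainTheorem12_general {Ω : Type*} [MeasurableSpace Ω] (P : Measure Ω)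
    [IsProbabilityMeasure P] {T N : ℕ} (α : ℝ) (hα : 1 ≤ α)
    (a : Fin (N + 1) → Fin T → ℂ)
    (D : Set (ℝ → Matrix (Fin T) (Fin T) ℂ)) (hD : ∀ f ∈ D, IsSpectralDensity α f)
    (f₀ : ℝ → Matrix (Fin T) (Fin T) ℂ) (hf₀ : f₀ ∈ D)
    (ξ : ℤ → Fin T → Ω → ℂ) (hξ : IsHarmonizable α P ξ f₀)
    (Y₀ : Ω → ℂ) (hY₀ : IsOptimalEstimate α P a ξ Y₀)
    (h₀ : ℝ → Fin T → ℂ) (hchar : HasCharacteristic α P N ξ f₀ Y₀ h₀)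
    (hmax : IsMaxOn (estError α a h₀) D f₀)
    (hHD : h₀ ∈ HD α N D) :
    optimalError α a f₀ = estError α a h₀ f₀ ∧
      IsLeastFavorable α a D f₀ ∧ IsMinimax α a D h₀ :=
  have hopt := optimalError_eq_estError_of_isOptimalEstimate hα (hD f₀ hf₀) hξ hY₀ hchar
  ⟨hopt, isLeastFavorable_of_isMaxOn hopt hf₀ hmax hHD, isMinimax_of_isMaxOn hopt hf₀ hmax hHD⟩

theorem mainTheorem12 {Ω : Type*} [MeasurableSpace Ω] (P : Measure Ω) [IsProbabilityMeasure P]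
    {T N : ℕ} (α : ℝ) (hα : 1 < α) (hα' : α ≤ 2)
    (a : Fin (N + 1) → Fin T → ℂ)
    (D : Set (ℝ → Matrix (Fin T) (Fin T) ℂ)) (hD : ∀ f ∈ D, IsSpectralDensity α f)
    (f₀ : ℝ → Matrix (Fin T) (Fin T) ℂ) (hf₀ : f₀ ∈ D) (hmin : IsMinimal α f₀)
    (ξ : ℤ → Fin T → Ω → ℂ) (hξ : IsHarmonizable α P ξ f₀)
    (Y₀ : Ω → ℂ) (hY₀ : IsOptimalEstimate α P a ξ Y₀)
    (h₀ : ℝ → Fin T → ℂ) (hchar : HasCharacteristic α P N ξ f₀ Y₀ h₀)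
    (hmax : IsMaxOn (estError α a h₀) D f₀)
    (hHD : h₀ ∈ HD α N D) :
    optimalError α a f₀ = estError α a h₀ f₀ ∧
      IsLeastFavorable α a D f₀ ∧ IsMinimax α a D h₀ :=
  mainTheorem12_general P α hα.le a D hD f₀ hf₀ ξ hξ Y₀ hY₀ h₀ hchar hmax hHD
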